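/- Let $k\ge 1$. For a word $w=w_1w_2\cdots w_n$ over the ordered alphabet $[k]=\{1,2,\dots,k\}$, a pair of positions $(i,j)$ with $1\le i<j\le n$ is called visible if $w_m<\min\{w_i,w_j\}$ for every $m$ with $i<m<j$ (in particular $(i,i+1)$ is always visible), and $\mathrm{vis}(w)$ denotes the number of visible pairs of $w$. Let $$F_k(x,q)=\sum_{n\ge0}x^n\sum_{w\in[k]^n}q^{\mathrm{vis}(w)},\qquad F_k'(x)=\frac{\partial}{\partial q}F_k(x,q)\Big|_{q=1}.$$ Then, as formal power series in $x$ over $\mathbb{Q}$ (quotients being taken in $\mathbb{Q}[[x]]$, where all the denominators have constant term $1$), $$F_k'(x)=\sum_{n\ge 0}x^n\sum_{w\in[k]^n}\mathrm{vis}(w) =2x^{2}\sum_{j=1}^{k}\frac{\displaystyle\sum_{i=1}^{j}\frac{1-(i-1)x+x\sum_{\ell=1}^{i-1}\frac{2-(2\ell-1)x}{1-(\ell-1)x}}{(1-(i-1)x)(1-ix)}}{(1-(j-1)x)(1-jx)} -x^{2}\sum_{j=1}^{k}\frac{1-(j-1)x+x\sum_{i=1}^{j-1}\frac{2-(2i-1)x}{1-(i-1)x}}{(1-(j-1)x)^{2}(1-jx)^{2}}.$$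 -/

import Mathlib

open scoped PowerSeries

/-- The pair of positions `(i, j)` of the word `w = w_1 ... w_n` is visible: `i < j` and every
letter strictly between the two positions is smaller than `min (w i) (w j)`. -/
def IsVisiblePair {α : Type*} [LinearOrder α] {n : ℕ} (w : Fin n → α) (i j : Fin n) : Prop :=
  i < j ∧ ∀ m : Fin n, i < m → m < j → w m < min (w i) (w j)

instance {α : Type*} [LinearOrder α] {n : ℕ} (w : Fin n → α) (i j : Fin n) :
    Decidable (IsVisiblePair w i j) :=
  inferInstanceAs (Decidable (i < j ∧ ∀ m : Fin n, i < m → m < j → w m < min (w i) (w j)))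

/-- `vis w` is the number of visible pairs of the word `w`. -/
def vis {α : Type*} [LinearOrder α] {n : ℕ} (w : Fin n → α) : ℕ :=
  (Finset.univ.filter fun p : Fin n × Fin n => IsVisiblePair w p.1 p.2).card

/-- The ordered alphabet `[k]` is modelled by `Fin k`, so `[k]^n` is `Fin n → Fin k`.
`genFun k` is `F_k(x, q) = ∑_{n ≥ 0} x^n ∑_{w ∈ [k]^n} q^{vis w}`, a formal power series in `x`
whose coefficients are polynomials in `q`. -/
noncomputable def genFun (k : ℕ) : (Polynomial ℚ)⟦X⟧ :=
  PowerSeries.mk fun n => ∑ w : Fin n → Fin k, (Polynomial.X : Polynomial ℚ) ^ vis w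

/-- `F_k'(x)`, the derivative of `F_k(x, q)` with respect to `q` at `q = 1`, which is taken
coefficientwise in `x`. -/
noncomputable def genFunDeriv (k : ℕ) : ℚ⟦X⟧ :=
  PowerSeries.mk fun n =>
    (Polynomial.derivative (PowerSeries.coeff n (genFun k))).eval 1

/-- The quotient of two formal power series over `ℚ`; it is only used for denominators with
constant coefficient `1`, which are invertible. -/
noncomputable def psFrac (a b : ℚ⟦X⟧) : ℚ⟦X⟧ := a * b⁻¹

/-! ### Identities for the inverses of `1 - n * x` in a commutative ring. -/

section Algebra

open Finset

variable {R : Type*} [CommRing R]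

/-! Exchange the sums over words and pairs. If a visible pair carries the letters `a`, `b` (counted
from 0), each letter between them has `min a b` choices and each letter outside has `k`
(`card_visible_of_letters`). With `e n = 1 / (1 - n * x)`, summing over positions gives the series
`x ^ 2 * e k ^ 2 * S`, where `S` sums `e (min a b)` over all `a, b < k` (`mk_sum_vis`). The stated
formula is a telescoped form of this product: `sum_mul_inverses_eq` evaluates its inner sum, and
`visible_rational_identity` the outer ones, by induction on `k`. -/

theorem sum_Icc_one_eq_sum_range (f : ℕ → R) (k : ℕ) :
    ∑ j ∈ Icc 1 k, f j = ∑ j ∈ range k, f (j + 1) := by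
  induction k with
  | zero => simp
  | succ k ih => rw [sum_Icc_succ_top (by omega), ih, sum_range_succ]

theorem sum_sum_min_succ (e : ℕ → R) (k : ℕ) :
    ∑ a ∈ range (k + 1), ∑ b ∈ range (k + 1), e (min a b) =
      (∑ a ∈ range k, ∑ b ∈ range k, e (min a b)) + 2 * (∑ a ∈ range k, e a) + e k := by
  have h₁ : ∑ a ∈ range k, e (min a k) = ∑ a ∈ range k, e a :=
    sum_congr rfl fun a ha => by rw [min_eq_left (mem_range.1 ha).le]
  have h₂ : ∑ b ∈ range k, e (min k b) = ∑ b ∈ range k, e b :=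
    sum_congr rfl fun b hb => by rw [min_eq_right (mem_range.1 hb).le]
  rw [sum_range_succ]
  simp only [sum_range_succ, sum_add_distrib, h₁, h₂, min_self]
  ring

variable {x : R} {e : ℕ → R}

/-- The minimum equals `a` for `2 * (k - a) - 1` pairs, and `x * (2 * (k - a) - 1)` is `2 * (1 - a *
x) - (2 * (1 - k * x) + x)`. This relation between the double and single sums drives both inductions
below. -/
theorem mul_sum_sum_min (he : ∀ n : ℕ, (1 - (n : R) * x) * e n = 1) (k : ℕ) :
    x * ∑ a ∈ range k, ∑ b ∈ range k, e (min a b) =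
      2 * k - (2 * (1 - (k : R) * x) + x) * ∑ a ∈ range k, e a := by
  induction k with
  | zero => simp
  | succ k ih =>
    rw [sum_sum_min_succ, sum_range_succ]
    push_cast
    linear_combination ih + 2 * he k

/-- Each summand collapses to `2 - x * e l`. -/
theorem add_mul_sum_eq (he : ∀ n : ℕ, (1 - (n : R) * x) * e n = 1) (k : ℕ) :
    1 - (k : R) * x + x * ∑ l ∈ range k, (2 - (2 * ((l : R) + 1) - 1) * x) * e l =
      1 + k * x - x ^ 2 * ∑ l ∈ range k, e l := by
  induction k with
  | zero => simp
  | succ k ih =>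
    rw [sum_range_succ, sum_range_succ]
    push_cast
    linear_combination ih + 2 * x * he k

theorem sum_mul_inverses_eq (he : ∀ n : ℕ, (1 - (n : R) * x) * e n = 1) (k : ℕ) :
    ∑ i ∈ range k, (1 + i * x - x ^ 2 * ∑ l ∈ range i, e l) * (e i * e (i + 1)) =
      x * e k * (∑ a ∈ range k, ∑ b ∈ range k, e (min a b)) + ∑ l ∈ range k, e l := by
  induction k with
  | zero => simp
  | succ k ih =>
    have h₁ := he (k + 1)
    have h₀ := he k
    have hS := mul_sum_sum_min he k
    push_cast at h₁
    rw [sum_range_succ, ih, sum_sum_min_succ, sum_range_succ]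
    generalize (∑ a ∈ range k, ∑ b ∈ range k, e (min a b)) = S at *
    generalize (∑ l ∈ range k, e l) = H at *
    generalize e k = p at *
    generalize e (k + 1) = q at *
    generalize (k : R) = c at *
    -- `R` need not be a field: the defect of the induction step is first shown to vanish after
    -- clearing denominators, then multiplied by the inverses `p * q`.
    have key : (1 - c * x) * (1 - (c + 1) * x) * (x * p * S + H + (1 + c * x - x ^ 2 * H) * (p * q)
        - (x * q * (S + 2 * H + p) + (H + p))) = 0 := by
      linear_combination (1 - (c + 1) * x) * x * S * h₀
        + (1 + c * x - x ^ 2 * H - x) * ((1 - (c + 1) * x) * q * h₀ + h₁)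
        - x * (S + 2 * H) * (1 - c * x) * h₁ - (1 - (c + 1) * x) * h₀ - x * hS
    linear_combination p * q * key - (x * p * S + H + (1 + c * x - x ^ 2 * H) * (p * q)
        - (x * q * (S + 2 * H + p) + (H + p))) * ((1 - (c + 1) * x) * q * h₀ + h₁)

theorem visible_rational_identity (he : ∀ n : ℕ, (1 - (n : R) * x) * e n = 1) (k : ℕ) :
    e k ^ 2 * ∑ a ∈ range k, ∑ b ∈ range k, e (min a b) =
      2 * ∑ j ∈ range k, (∑ i ∈ range (j + 1),
        (1 + i * x - x ^ 2 * ∑ l ∈ range i, e l) * (e i * e (i + 1))) * (e j * e (j + 1))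
      - ∑ j ∈ range k, (1 + j * x - x ^ 2 * ∑ l ∈ range j, e l) * (e j ^ 2 * e (j + 1) ^ 2) := by
  simp only [sum_mul_inverses_eq he]
  induction k with
  | zero => simp
  | succ k ih =>
    have h₁ := he (k + 1)
    have h₀ := he k
    have hS := mul_sum_sum_min he k
    push_cast at h₁
    rw [sum_range_succ (fun j => _ * (e j * e (j + 1))), sum_range_succ (fun j => _ * (e j ^ 2 * _)),
      sum_sum_min_succ, sum_range_succ e]
    generalize (∑ a ∈ range k, ∑ b ∈ range k, e (min a b)) = S at *
    generalize (∑ l ∈ range k, e l) = H at *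
    generalize e k = p at *
    generalize e (k + 1) = q at *
    generalize (k : R) = c at *
    -- The increment from `k` to `k + 1` with denominators cleared; multiplying by `p ^ 2 * q ^ 2`
    -- restores them.
    have base : (1 - c * x) ^ 2 * (S + 2 * H) + (1 - c * x) - (1 - (c + 1) * x) ^ 2 * S =
        2 * ((1 - c * x) * x * (S + 2 * H) + x + (1 - c * x) * (1 - (c + 1) * x) * H
          + (1 - (c + 1) * x)) - (1 + c * x - x ^ 2 * H) := by
      linear_combination -x * hS
    linear_combination ih + p ^ 2 * q ^ 2 * base
      - q ^ 2 * (S + 2 * H) * ((1 - c * x) * p + 1) * h₀ - q ^ 2 * p * h₀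
      + p ^ 2 * S * ((1 - (c + 1) * x) * q + 1) * h₁
      + 2 * (p * x * q ^ 2 * (S + 2 * H) * h₀
        + H * p * q * ((1 - (c + 1) * x) * q * h₀ + h₁) + p ^ 2 * q * h₁)

end Algebra

/-! ### Power series: convolutions, geometric series, quotients. -/

section Series

open Finset PowerSeries

theorem mk_sum_range_mul (a b : ℕ → ℚ) :
    (PowerSeries.mk fun n => ∑ j ∈ range n, a j * b (n - 1 - j)) =
      X * PowerSeries.mk a * PowerSeries.mk b := by
  ext n
  cases n with
  | zero => simp [mul_assoc]
  | succ n =>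
    rw [mul_assoc, coeff_succ_X_mul, coeff_mk, coeff_mul, Nat.sum_antidiagonal_eq_sum_range_succ_mk]
    simp

theorem one_sub_mul_mk_pow (n : ℕ) :
    (1 - (n : ℚ⟦X⟧) * X) * PowerSeries.mk (fun m => (n : ℚ) ^ m) = 1 := by
  ext m
  cases m with
  | zero => simp [sub_mul]
  | succ m =>
    rw [sub_mul, mul_assoc, ← map_natCast (C (R := ℚ)) n, map_sub, coeff_C_mul, coeff_succ_X_mul]
    simp [coeff_one, pow_succ']

theorem psFrac_eq_mul {b c : ℚ⟦X⟧} (a : ℚ⟦X⟧) (h : b * c = 1) : psFrac a b = a * c := by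
  have hb : constantCoeff b ≠ 0 := by
    intro h0
    have := congrArg (constantCoeff (R := ℚ)) h
    simp [h0] at this
  have : b⁻¹ = c := by
    rw [← mul_one b⁻¹, ← h, ← mul_assoc, PowerSeries.inv_mul_cancel b hb, one_mul]
  rw [psFrac, this]

theorem genFunDeriv_eq (k : ℕ) :
    genFunDeriv k = PowerSeries.mk (fun n => ((∑ w : Fin n → Fin k, vis w : ℕ) : ℚ)) := by
  ext n
  simp [genFunDeriv, genFun, Polynomial.eval_finsetSum, Polynomial.derivative_X_pow]

end Series

/-! ### Counting words in which a given pair is visible. -/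

section Counting

open Finset

theorem prod_range_visible (k c i m r : ℕ) :
    ∏ p ∈ range (i + 1 + m + 1 + r),
      (if p = i ∨ p = i + 1 + m then 1 else if i < p ∧ p < i + 1 + m then c else k) =
    k ^ i * c ^ m * k ^ r := by
  rw [prod_range_add, prod_range_succ, prod_range_add, prod_range_succ]
  have h₁ : ∀ p ∈ range i,
      (if p = i ∨ p = i + 1 + m then 1 else if i < p ∧ p < i + 1 + m then c else k) = k := by
    intro p hp
    have := mem_range.1 hp
    rw [if_neg (by omega), if_neg (by omega)]
  have h₂ : ∀ p ∈ range m, (if i + 1 + p = i ∨ i + 1 + p = i + 1 + m then 1 else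
      if i < i + 1 + p ∧ i + 1 + p < i + 1 + m then c else k) = c := by
    intro p hp
    have := mem_range.1 hp
    rw [if_neg (by omega), if_pos (by omega)]
  have h₃ : ∀ p ∈ range r, (if i + 1 + m + 1 + p = i ∨ i + 1 + m + 1 + p = i + 1 + m then 1 else
      if i < i + 1 + m + 1 + p ∧ i + 1 + m + 1 + p < i + 1 + m then c else k) = k := by
    intro p _
    rw [if_neg (by omega), if_neg (by omega)]
  rw [prod_congr rfl h₁, prod_congr rfl h₂, prod_congr rfl h₃]
  simp

theorem card_visible_of_letters {n k : ℕ} {i j : Fin n} (hij : i < j) (a b : Fin k) :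
    (univ.filter fun w : Fin n → Fin k => IsVisiblePair w i j ∧ w i = a ∧ w j = b).card =
      k ^ (i : ℕ) * (min (a : ℕ) b) ^ (j - 1 - i : ℕ) * k ^ (n - 1 - j : ℕ) := by
  -- Once both end letters are fixed, visibility constrains each position independently, so the
  -- words form a box.
  have hset : (univ.filter fun w : Fin n → Fin k => IsVisiblePair w i j ∧ w i = a ∧ w j = b) =
      Fintype.piFinset fun p : Fin n =>
        if p = i then {a} else if p = j then {b} else
          if i < p ∧ p < j then Iio (min a b) else univ := by
    ext w
    rw [mem_filter, Fintype.mem_piFinset]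
    simp only [mem_univ, true_and, IsVisiblePair]
    constructor
    · rintro ⟨⟨-, h⟩, rfl, rfl⟩ p
      split_ifs with h₁ h₂ h₃
      · simp [h₁]
      · simp [h₂]
      · exact mem_Iio.2 (h p h₃.1 h₃.2)
      · simp
    · intro h
      have hi : w i = a := by simpa using h i
      have hj : w j = b := by simpa [hij.ne'] using h j
      refine ⟨⟨hij, fun p h₁ h₂ => ?_⟩, hi, hj⟩
      have := h p
      rw [if_neg h₁.ne', if_neg h₂.ne, if_pos ⟨h₁, h₂⟩] at this
      rw [hi, hj]
      exact mem_Iio.1 this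
  obtain ⟨i, hi⟩ := i
  obtain ⟨j, hj⟩ := j
  obtain ⟨m, rfl⟩ : ∃ m, j = i + 1 + m := Nat.exists_eq_add_of_le hij
  obtain ⟨r, rfl⟩ : ∃ r, n = i + 1 + m + 1 + r := Nat.exists_eq_add_of_le hj
  rw [hset, Fintype.card_piFinset]
  have e₁ : i + 1 + m - 1 - i = m := by omega
  have e₂ : i + 1 + m + 1 + r - 1 - (i + 1 + m) = r := by omega
  simp only [e₁, e₂]
  rw [← prod_range_visible, ← Fin.prod_univ_eq_prod_range
    (fun p => if p = i ∨ p = i + 1 + m then 1 else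
      if i < p ∧ p < i + 1 + m then min (a : ℕ) b else k)]
  refine prod_congr rfl fun p _ => ?_
  simp only [Fin.ext_iff, Fin.lt_def]
  split_ifs <;> first | omega | simp_all

theorem card_visible {n k : ℕ} {i j : Fin n} (hij : i < j) :
    (univ.filter fun w : Fin n → Fin k => IsVisiblePair w i j).card =
      k ^ (i : ℕ) * (∑ a ∈ range k, ∑ b ∈ range k, (min a b) ^ (j - 1 - i : ℕ)) *
        k ^ (n - 1 - j : ℕ) := by
  rw [card_eq_sum_card_fiberwise (f := fun w => (w i, w j)) (t := univ) (fun _ _ => mem_univ _),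
    Fintype.sum_prod_type]
  simp only [filter_filter, Prod.mk.injEq, card_visible_of_letters hij]
  simp only [← mul_sum, ← sum_mul]
  rw [← Fin.sum_univ_eq_sum_range (fun a => ∑ b ∈ range k, (min a b) ^ (j - 1 - i : ℕ))]
  simp only [← Fin.sum_univ_eq_sum_range]

theorem sum_vis (n k : ℕ) :
    ∑ w : Fin n → Fin k, vis w = ∑ j ∈ range n, (∑ i ∈ range j,
      k ^ i * ∑ a ∈ range k, ∑ b ∈ range k, (min a b) ^ (j - 1 - i)) * k ^ (n - 1 - j) := by
  have h : ∑ w : Fin n → Fin k, vis w =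
      ∑ j : Fin n, ∑ i : Fin n, (univ.filter fun w : Fin n → Fin k => IsVisiblePair w i j).card := by
    simp only [vis, card_filter, Fintype.sum_prod_type]
    exact (sum_congr rfl fun w _ => sum_comm).trans
      (sum_comm.trans (sum_congr rfl fun j _ => sum_comm))
  rw [h, ← Fin.sum_univ_eq_sum_range (fun j => (∑ i ∈ range j,
      k ^ i * ∑ a ∈ range k, ∑ b ∈ range k, (min a b) ^ (j - 1 - i)) * k ^ (n - 1 - j))]
  refine sum_congr rfl fun j _ => ?_
  have hz : ∀ i : Fin n, (univ.filter fun w : Fin n → Fin k => IsVisiblePair w i j).card =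
      if (i : ℕ) < j then k ^ (i : ℕ) * (∑ a ∈ range k, ∑ b ∈ range k, (min a b) ^ (j - 1 - i : ℕ)) *
        k ^ (n - 1 - j : ℕ) else 0 := by
    intro i
    split_ifs with hij
    · exact card_visible hij
    · exact card_eq_zero.2 (filter_eq_empty_iff.2 fun w _ hw => hij hw.1)
  rw [sum_congr rfl fun i _ => hz i, Fin.sum_univ_eq_sum_range (fun i => if i < (j : ℕ) then
    k ^ i * (∑ a ∈ range k, ∑ b ∈ range k, (min a b) ^ (j - 1 - i : ℕ)) * k ^ (n - 1 - j : ℕ)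
    else 0), ← sum_filter, sum_mul]
  refine sum_congr ?_ fun _ _ => rfl
  ext i
  have := j.2
  simp only [mem_filter, mem_range]
  omega

end Counting

/-! ### Assembly of the generating function. -/

section Main

open Finset PowerSeries

theorem mk_sum_vis (k : ℕ) :
    (PowerSeries.mk fun n => ((∑ w : Fin n → Fin k, vis w : ℕ) : ℚ)) =
      X ^ 2 * (PowerSeries.mk (fun m => (k : ℚ) ^ m) ^ 2 * ∑ a ∈ range k, ∑ b ∈ range k,
        PowerSeries.mk fun m => ((min a b : ℕ) : ℚ) ^ m) := by
  have h : (∑ a ∈ range k, ∑ b ∈ range k, PowerSeries.mk fun m => ((min a b : ℕ) : ℚ) ^ m) =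
      PowerSeries.mk fun m => ∑ a ∈ range k, ∑ b ∈ range k, ((min a b : ℕ) : ℚ) ^ m := by
    ext m
    simp only [map_sum, coeff_mk]
  have h' := mk_sum_range_mul (fun j => ∑ i ∈ range j, (k : ℚ) ^ i *
    ∑ a ∈ range k, ∑ b ∈ range k, ((min a b : ℕ) : ℚ) ^ (j - 1 - i)) (fun m => (k : ℚ) ^ m)
  -- The count is a nested convolution of prefix, gap and suffix; each of the two convolutions
  -- contributes one factor `X`, for an end of the pair.
  rw [mk_sum_range_mul (fun i => (k : ℚ) ^ i)
    (fun m => ∑ a ∈ range k, ∑ b ∈ range k, ((min a b : ℕ) : ℚ) ^ m)] at h'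
  rw [h]
  simp only [sum_vis]
  push_cast at h' ⊢
  rw [h']
  ring

end Main

theorem mainTheorem5 (k : ℕ) (hk : 1 ≤ k) :
    let x : ℚ⟦X⟧ := PowerSeries.X
    genFunDeriv k = PowerSeries.mk (fun n => ((∑ w : Fin n → Fin k, vis w : ℕ) : ℚ)) ∧
    PowerSeries.mk (fun n => ((∑ w : Fin n → Fin k, vis w : ℕ) : ℚ)) =
      2 * x ^ 2 * ∑ j ∈ Finset.Icc 1 k,
          psFrac
            (∑ i ∈ Finset.Icc 1 j,
              psFrac
                (1 - ((i : ℚ⟦X⟧) - 1) * x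
                  + x * ∑ l ∈ Finset.Icc 1 (i - 1),
                      psFrac (2 - (2 * (l : ℚ⟦X⟧) - 1) * x) (1 - ((l : ℚ⟦X⟧) - 1) * x))
                ((1 - ((i : ℚ⟦X⟧) - 1) * x) * (1 - (i : ℚ⟦X⟧) * x)))
            ((1 - ((j : ℚ⟦X⟧) - 1) * x) * (1 - (j : ℚ⟦X⟧) * x))
      - x ^ 2 * ∑ j ∈ Finset.Icc 1 k,
          psFrac
            (1 - ((j : ℚ⟦X⟧) - 1) * x
              + x * ∑ i ∈ Finset.Icc 1 (j - 1),
                  psFrac (2 - (2 * (i : ℚ⟦X⟧) - 1) * x) (1 - ((i : ℚ⟦X⟧) - 1) * x))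
            ((1 - ((j : ℚ⟦X⟧) - 1) * x) ^ 2 * (1 - (j : ℚ⟦X⟧) * x) ^ 2) := by
  intro x
  refine ⟨genFunDeriv_eq k, ?_⟩
  set e : ℕ → ℚ⟦X⟧ := fun n => PowerSeries.mk fun m => (n : ℚ) ^ m with he_def
  have he : ∀ n : ℕ, (1 - (n : ℚ⟦X⟧) * x) * e n = 1 := one_sub_mul_mk_pow
  have he' : ∀ n : ℕ, (1 - ((n : ℚ⟦X⟧) + 1) * x) * e (n + 1) = 1 := fun n => by
    simpa using he (n + 1)
  have h₂ : ∀ n : ℕ, (1 - (n : ℚ⟦X⟧) * x) * (1 - ((n : ℚ⟦X⟧) + 1) * x) * (e n * e (n + 1)) = 1 :=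
    fun n => by rw [mul_mul_mul_comm, he, he', one_mul]
  have h₃ : ∀ n : ℕ, (1 - (n : ℚ⟦X⟧) * x) ^ 2 * (1 - ((n : ℚ⟦X⟧) + 1) * x) ^ 2 *
      (e n ^ 2 * e (n + 1) ^ 2) = 1 :=
    fun n => by rw [← mul_pow, ← mul_pow, ← mul_pow, h₂, one_pow]
  -- Shifting indices to start at 0 turns each `1 - (i - 1) * x` into `1 - i * x`, with inverse `e
  -- i`.
  simp only [sum_Icc_one_eq_sum_range, Nat.add_sub_cancel, Nat.cast_add, Nat.cast_one,
    add_sub_cancel_right, psFrac_eq_mul _ (he _), psFrac_eq_mul _ (h₂ _), psFrac_eq_mul _ (h₃ _),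
    add_mul_sum_eq he]
  rw [mk_sum_vis]
  linear_combination x ^ 2 * visible_rational_identity he k
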